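/- For $n\in\mathbb N$ and $\mathbf x,\mathbf y\in\{0,1\}^n$ let $|\mathbf x|$ be the Hamming weight and $\Delta(\mathbf x,\mathbf y)$ the Hamming distance. For natural numbers $n,a,b,c,g$ let $\mathrm{exact\text{-}GHD}^n_{a,b,c,g}:\{0,1\}^n\times\{0,1\}^n\to\{0,1,?\}$ be the partial function that, for $|\mathbf x|=a$ and $|\mathbf y|=b$, equals $1$ if $\Delta(\mathbf x,\mathbf y)=c+g$ and $0$ if $\Delta(\mathbf x,\mathbf y)=c-g$, and that is undefined ($?$) in all other cases. The parameters are called meaningful if $g\ge 1$, $a,b\le n$, and both $c+g$ and $c-g$ are Hamming distances $\Delta(\mathbf x,\mathbf y)$ of some $\mathbf x,\mathbf y\in\{0,1\}^n$ with $|\mathbf x|=a$, $|\mathbf y|=b$. For a partial function $f:\{0,1\}^n\times\{0,1\}^n\to\{0,1,?\}$ let $R^{\text{1-way}}(f)$ be the least $k$ for which there is a public-coin randomized protocol in which Alice, given $\mathbf x$, sends a single message of $k$ bits to Bob, and Bob, given $\mathbf y$ and the message, outputs a bit, such that on every $(\mathbf x,\mathbf y)$ with $f(\mathbf x,\mathbf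 y)\neq{?}$ the output equals $f(\mathbf x,\mathbf y)$ with probability at least $2/3$. **Lemma.** There is a universal constant $C>0$ such that for all meaningful $n,a,b,c,g$, $$R^{\text{1-way}}(\mathrm{exact\text{-}GHD}^n_{a,b,c,g})\ \ge\ \frac1C\cdot\frac{\min\{a,\,n-a,\,c,\,n-c\}}{g}$$ and $$R^{\text{1-way}}(\mathrm{exact\text{-}GHD}^n_{a,b,c,g})\ \ge\ \frac1C\cdot\log_2\left(\frac{\min\{c,\,n-c\}}{g}\right).$$ -/

import Mathlib

open MeasureTheory

/-- Binary strings of length `n`. -/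
abbrev BitStr (n : ℕ) : Type := Fin n → Bool

/-- The Hamming weight `|x|`: the number of coordinates of `x` that are equal to `1`. The Hamming
distance is Mathlib's `hammingDist`. -/
def hammingWeight {n : ℕ} (x : BitStr n) : ℕ :=
  (Finset.univ.filter fun i => x i = true).card

/-- A one-way communication protocol with public randomness in which Alice sends `k` bits to Bob.
A random `ω` is drawn from a probability space and seen by both parties. Alice computes her message
from `ω` and her input, Bob computes the output from `ω`, the message and his input. Both
computations depend measurably on `ω`. The communication cost of the protocol is `k`. -/
structure OneWayProtocol (n k : ℕ) where
  /-- the space of the public randomness -/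
  Ω : Type
  [mΩ : MeasurableSpace Ω]
  /-- the law of the public randomness -/
  P : Measure Ω
  [isProb : IsProbabilityMeasure P]
  /-- Alice's message -/
  message : Ω → BitStr n → BitStr k
  measurable_message : ∀ x, Measurable fun ω => message ω x
  /-- Bob's output -/
  output : Ω → BitStr k → BitStr n → Bool
  measurable_output : ∀ m y, Measurable fun ω => output ω m y

attribute [instance] OneWayProtocol.mΩ OneWayProtocol.isProb

/-- The output of the protocol on the input pair `(x, y)` when the public randomness is `ω`. -/
def OneWayProtocol.run {n k : ℕ} (π : OneWayProtocol n k) (x y : BitStr n) (ω : π.Ω) : Bool :=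
  π.output ω (π.message ω x) y

/-- The protocol computes the partial function `f` (where `none` stands for the undefined value
`?`): on every input pair on which `f` is defined, the output is correct with probability at least
`2/3`. -/
def OneWayProtocol.Computes {n k : ℕ} (π : OneWayProtocol n k)
    (f : BitStr n → BitStr n → Option Bool) : Prop :=
  ∀ (x y : BitStr n) (v : Bool), f x y = some v → (2 / 3 : ℝ) ≤ π.P.real {ω | π.run x y ω = v}

/-- The one-way randomized communication complexity of a partial function `f`: the least cost of a
one-way public-coin protocol (only Alice speaks) that computes `f`. -/
noncomputable def oneWayCC {n : ℕ} (f : BitStr n → BitStr n → Option Bool) : ℕ :=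
  sInf {k : ℕ | ∃ π : OneWayProtocol n k, π.Computes f}

/-- The minimum that defines `oneWayCC` is over a nonempty set: Alice can send her whole input. -/
theorem oneWayCC_set_nonempty {n : ℕ} (f : BitStr n → BitStr n → Option Bool) :
    {k : ℕ | ∃ π : OneWayProtocol n k, π.Computes f}.Nonempty := by
  refine ⟨n, ⟨Unit, Measure.dirac (), fun _ x => x, fun _ => measurable_const,
    fun _ m y => (f m y).getD false, fun _ _ => measurable_const⟩, ?_⟩
  intro x y v hv
  simp [OneWayProtocol.run, hv]
  norm_num

/-- The partial function exact Gap-Hamming-Distance with parameters `n, a, b, c, g`: for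
`|x| = a` and `|y| = b` it is `1` if `Δ(x, y) = c + g` and `0` if `Δ(x, y) = c - g` (subtraction in
the integers), and it is undefined otherwise. -/
def exactGHD (n a b c g : ℕ) (x y : BitStr n) : Option Bool :=
  if hammingWeight x = a ∧ hammingWeight y = b then
    if (hammingDist x y : ℤ) = (c : ℤ) + g then some true
    else if (hammingDist x y : ℤ) = (c : ℤ) - g then some false
    else none
  else none

/-- The parameters are meaningful: the gap `g` is positive, `a, b ≤ n`, and both `c + g` and
`c - g` are Hamming distances of strings of length `n` and weights `a` and `b`. -/
def MeaningfulGHD (n a b c g : ℕ) : Prop :=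
  0 < g ∧ a ≤ n ∧ b ≤ n ∧
  (∃ x y : BitStr n, hammingWeight x = a ∧ hammingWeight y = b ∧
    (hammingDist x y : ℤ) = (c : ℤ) + g) ∧
  (∃ x y : BitStr n, hammingWeight x = a ∧ hammingWeight y = b ∧
    (hammingDist x y : ℤ) = (c : ℤ) - g)

/-! Reduction from the index problem: if Bob can recover any single bit of an `m`-bit string, Alice
must send at least `m / 15` bits. Split coordinates by the pair `(x i, y i)`: `A`, `B`, `D`, `E`
count the pairs 11, 10, 01, 00 left besides `2 * g` coordinates that create the gap. Index embeds
with `m` about `min B E / g` (`exists_gap_strings`) or, after complementing `y`, about `min A D /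
g`. This bounds one of `a`, `n - a`, `c`, `n - c`. For the logarithmic bound, Bob sends his answers
to all `2 ^ k` messages, which swaps the players at exponential cost and adds `min D E` and `min A
B`. -/

theorem OneWayProtocol.measurableSet_run_eq {n k : ℕ} (π : OneWayProtocol n k) (x y : BitStr n)
    (v : Bool) : MeasurableSet {ω | π.run x y ω = v} := by
  have h : {ω | π.run x y ω = v} =
      ⋃ μ : BitStr k, {ω | π.message ω x = μ} ∩ {ω | π.output ω μ y = v} := by
    ext ω
    simp [OneWayProtocol.run]
  rw [h]
  exact MeasurableSet.iUnion fun μ =>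
    (π.measurable_message x (measurableSet_singleton μ)).inter
      (π.measurable_output μ y (measurableSet_singleton v))

/-- The protocol in which Bob sends the table of his answers to all messages of Alice. -/
noncomputable def OneWayProtocol.transpose {n k : ℕ} (π : OneWayProtocol n k) :
    OneWayProtocol n (2 ^ k) :=
  let e : Fin (2 ^ k) ≃ BitStr k := Fintype.equivOfCardEq (by simp)
  { Ω := π.Ω
    P := π.P
    message := fun ω y j => π.output ω (e j) y
    measurable_message := fun y => measurable_pi_lambda _ fun j => π.measurable_output (e j) y
    output := fun ω T x => T (e.symm (π.message ω x))
    measurable_output := fun T x =>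
      (Measurable.of_discrete (f := fun μ => T (e.symm μ))).comp (π.measurable_message x) }

theorem OneWayProtocol.Computes.transpose {n k : ℕ} {π : OneWayProtocol n k}
    {f : BitStr n → BitStr n → Option Bool} (h : π.Computes f) :
    π.transpose.Computes fun x y => f y x := by
  intro x y v hv
  have key : ∀ ω, π.transpose.run x y ω = π.run y x ω := fun ω => by
    simp [OneWayProtocol.run, OneWayProtocol.transpose]
  have hset : {ω | π.transpose.run x y ω = v} = {ω | π.run y x ω = v} := by
    ext ω
    exact Eq.congr_left (key ω)
  rw [hset]
  exact h y x v hv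

theorem OneWayProtocol.Computes.measureReal_run_ne_le {n k : ℕ} {π : OneWayProtocol n k}
    {f : BitStr n → BitStr n → Option Bool} (h : π.Computes f) {x y : BitStr n} {v : Bool}
    (hv : f x y = some v) : π.P.real {ω | π.run x y ω ≠ v} ≤ 1 / 3 := by
  have h1 := h x y v hv
  have h2 := probReal_compl_eq_one_sub (μ := π.P) (π.measurableSet_run_eq x y v)
  have h3 : {ω | π.run x y ω = v}ᶜ = {ω | π.run x y ω ≠ v} := rfl
  rw [h3] at h2
  linarith

/-! ### Lower bound for the index problem -/

theorem sum_half_pow_hammingDist {m : ℕ} (w : BitStr m) :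
    ∑ z : BitStr m, (1 / 2 : ℝ) ^ hammingDist z w = (3 / 2) ^ m := by
  have h1 : ∀ z : BitStr m, (1 / 2 : ℝ) ^ hammingDist z w =
      ∏ i, if z i ≠ w i then (1 / 2 : ℝ) else 1 := fun z => by
    rw [Finset.prod_ite, hammingDist]
    simp
  have h2 := Finset.prod_univ_sum (fun _ : Fin m => (Finset.univ : Finset Bool))
    (fun i b => if b ≠ w i then (1 / 2 : ℝ) else 1)
  rw [Fintype.piFinset_univ] at h2
  simp_rw [h1]
  rw [← h2]
  have h3 : ∀ i, (∑ b : Bool, if b ≠ w i then (1 / 2 : ℝ) else 1) = 3 / 2 := fun i => by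
    cases w i <;> norm_num
  rw [Finset.prod_congr rfl fun i _ => h3 i, Finset.prod_const, Finset.card_univ, Fintype.card_fin]

/-- Jensen's inequality for `2 ^ (-t)`, via its tangent line at `s`. -/
theorem card_mul_half_rpow_le_sum {ι : Type*} [Fintype ι] (N : ι → ℕ) (s : ℝ)
    (h : ∑ z, (N z : ℝ) ≤ Fintype.card ι * s) :
    Fintype.card ι * Real.exp (-(Real.log 2 * s)) ≤ ∑ z, (1 / 2 : ℝ) ^ N z := by
  have hL : 0 < Real.log 2 := Real.log_pos one_lt_two
  have h1 : ∀ z, Real.exp (-(Real.log 2 * s)) * (1 - Real.log 2 * (N z - s)) ≤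
      (1 / 2 : ℝ) ^ N z := fun z => by
    have h2 : (1 / 2 : ℝ) ^ N z =
        Real.exp (-(Real.log 2 * s)) * Real.exp (-(Real.log 2 * (N z - s))) := by
      rw [← Real.exp_add]
      have : -(Real.log 2 * s) + -(Real.log 2 * (N z - s)) = N z * (-Real.log 2) := by ring
      rw [this, Real.exp_nat_mul, Real.exp_neg, Real.exp_log two_pos]
      norm_num
    rw [h2]
    refine mul_le_mul_of_nonneg_left ?_ (Real.exp_pos _).le
    linarith [Real.add_one_le_exp (-(Real.log 2 * (N z - s)))]
  refine le_trans ?_ (Finset.sum_le_sum fun z _ => h1 z)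
  rw [← Finset.mul_sum, mul_comm]
  refine mul_le_mul_of_nonneg_left ?_ (Real.exp_pos _).le
  rw [Finset.sum_sub_distrib, ← Finset.mul_sum, Finset.sum_sub_distrib]
  simp only [Finset.sum_const, Finset.card_univ, nsmul_eq_mul, mul_one]
  nlinarith

/-- Lower bound for the index problem: a deterministic assignment of `2 ^ k` codewords that
approximates the strings of length `m` with an average error of `m / 3` needs `m ≤ 15 * k`. -/
theorem le_of_sum_hammingDist_le {m k : ℕ} (M : BitStr m → BitStr k) (S : BitStr k → BitStr m)
    (h : ∑ z, (hammingDist z (S (M z)) : ℝ) ≤ 2 ^ m * (m / 3)) : m ≤ 15 * k := by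
  have h1 := card_mul_half_rpow_le_sum (fun z => hammingDist z (S (M z))) (m / 3) (by simpa using h)
  have h2 : ∑ z, (1 / 2 : ℝ) ^ hammingDist z (S (M z)) ≤ 2 ^ k * (3 / 2) ^ m := by
    calc ∑ z, (1 / 2 : ℝ) ^ hammingDist z (S (M z))
        ≤ ∑ z, ∑ μ, (1 / 2 : ℝ) ^ hammingDist z (S μ) := Finset.sum_le_sum fun z _ =>
          Finset.single_le_sum (f := fun μ => (1 / 2 : ℝ) ^ hammingDist z (S μ))
            (fun μ _ => by positivity) (Finset.mem_univ (M z))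
      _ = 2 ^ k * (3 / 2) ^ m := by
          rw [Finset.sum_comm]
          rw [Finset.sum_congr rfl fun μ _ => sum_half_pow_hammingDist (S μ)]
          simp
  have h3 : (2 : ℝ) ^ m * Real.exp (-(Real.log 2 * (m / 3))) ≤ 2 ^ k * (3 / 2) ^ m := by
    refine le_trans ?_ h2
    simpa using h1
  -- Cubing clears the exponent `m / 3`.
  have h4 := pow_le_pow_left₀ (by positivity) h3 3
  have h5 : Real.exp (-(Real.log 2 * (m / 3))) ^ 3 = (1 / 2) ^ m := by
    rw [← Real.exp_nat_mul]
    have : ((3 : ℕ) : ℝ) * -(Real.log 2 * (m / 3)) = m * (-Real.log 2) := by push_cast; ring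
    rw [this, Real.exp_nat_mul, Real.exp_neg, Real.exp_log two_pos]
    norm_num
  have h6 : (32 / 27 : ℝ) ^ m ≤ 8 ^ k := by
    rw [mul_pow, mul_pow, h5, ← pow_mul, ← pow_mul, ← pow_mul, mul_comm m, mul_comm k, pow_mul,
      pow_mul, pow_mul, ← mul_pow] at h4
    norm_num at h4
    have h7 : (32 / 27 : ℝ) ^ m * (27 / 8) ^ m = 4 ^ m := by rw [← mul_pow]; norm_num
    rw [← h7] at h4
    exact le_of_mul_le_mul_right h4 (by positivity)
  by_contra! hlt
  have h8 : (32 / 27 : ℝ) ^ (15 * k) < (32 / 27) ^ m := pow_lt_pow_right₀ (by norm_num) hlt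
  -- The constant 15 is large enough for `8 ≤ (32 / 27) ^ 15`.
  have h9 : (8 : ℝ) ^ k ≤ (32 / 27) ^ (15 * k) := by
    rw [pow_mul]
    exact pow_le_pow_left₀ (by norm_num) (by norm_num) k
  linarith

/-- The index problem on `m` bits embeds into `f`. -/
def IndexEmbeds {n : ℕ} (m : ℕ) (f : BitStr n → BitStr n → Option Bool) : Prop :=
  ∃ (X : BitStr m → BitStr n) (Y : Fin m → BitStr n), ∀ z i, f (X z) (Y i) = some (z i)

/-- The expected number of wrong bits, summed over all `z`, is at most `2 ^ m * (m / 3)`, so some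
fixed `ω` does as well. Bob's answers on all `Y i` then decode each message to a codeword. -/
theorem IndexEmbeds.le_of_computes {n m k : ℕ} {f : BitStr n → BitStr n → Option Bool}
    (hf : IndexEmbeds m f) {π : OneWayProtocol n k} (hπ : π.Computes f) : m ≤ 15 * k := by
  obtain ⟨X, Y, hXY⟩ := hf
  let err : BitStr m → Fin m → Set π.Ω := fun z i => {ω | π.run (X z) (Y i) ω ≠ z i}
  have hmeas : ∀ z i, MeasurableSet (err z i) := fun z i =>
    (π.measurableSet_run_eq (X z) (Y i) (z i)).compl
  have hint : ∀ z i, Integrable ((err z i).indicator (1 : π.Ω → ℝ)) π.P := fun z i =>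
    (integrable_const (1 : ℝ)).indicator (hmeas z i)
  obtain ⟨ω, hω⟩ := exists_le_integral (μ := π.P)
    (f := fun ω => ∑ z, ∑ i, (err z i).indicator (1 : π.Ω → ℝ) ω)
    (integrable_finsetSum _ fun z _ => integrable_finsetSum _ fun i _ => hint z i)
  rw [integral_finsetSum _ fun z _ => integrable_finsetSum _ fun i _ => hint z i] at hω
  refine le_of_sum_hammingDist_le (fun z => π.message ω (X z))
    (fun μ i => π.output ω μ (Y i)) ?_
  calc ∑ z, (hammingDist z (fun i => π.output ω (π.message ω (X z)) (Y i)) : ℝ)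
      = ∑ z, ∑ i, (err z i).indicator (1 : π.Ω → ℝ) ω := by
        refine Finset.sum_congr rfl fun z _ => ?_
        rw [hammingDist, Finset.natCast_card_filter]
        refine Finset.sum_congr rfl fun i _ => ?_
        simp [err, Set.indicator_apply, OneWayProtocol.run, eq_comm]
    _ ≤ _ := hω
    _ ≤ ∑ z : BitStr m, ∑ i : Fin m, (1 / 3 : ℝ) := by
        refine Finset.sum_le_sum fun z _ => ?_
        rw [integral_finsetSum _ fun i _ => hint z i]
        refine Finset.sum_le_sum fun i _ => ?_
        rw [integral_indicator_one (hmeas z i)]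
        exact hπ.measureReal_run_ne_le (hXY z i)
    _ = 2 ^ m * (m / 3) := by
        simp
        ring

/-! ### Embedding index into exact GHD -/

theorem hammingWeight_comp_equiv {n : ℕ} {ι : Type*} [Fintype ι] (e : Fin n ≃ ι) (u : ι → Bool) :
    hammingWeight (fun j => u (e j)) = ∑ s, (u s).toNat := by
  rw [hammingWeight, Finset.card_filter, ← e.sum_comp]
  refine Finset.sum_congr rfl fun j _ => ?_
  cases u (e j) <;> rfl

theorem hammingDist_comp_equiv {n : ℕ} {ι : Type*} [Fintype ι] (e : Fin n ≃ ι) (u v : ι → Bool) :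
    hammingDist (fun j => u (e j)) (fun j => v (e j)) = ∑ s, (u s ^^ v s).toNat := by
  rw [hammingDist, Finset.card_filter, ← e.sum_comp]
  refine Finset.sum_congr rfl fun j _ => ?_
  cases u (e j) <;> cases v (e j) <;> rfl

theorem hammingWeight_not {n : ℕ} (x : BitStr n) :
    hammingWeight x + hammingWeight (fun i => !x i) = n := by
  have h := Finset.card_filter_add_card_filter_not (s := (Finset.univ : Finset (Fin n)))
    fun i => x i = true
  simpa [hammingWeight] using h

theorem hammingDist_not_right {n : ℕ} (x y : BitStr n) :
    hammingDist x y + hammingDist x (fun i => !y i) = n := by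
  have h := Finset.card_filter_add_card_filter_not (s := (Finset.univ : Finset (Fin n)))
    fun i => x i ≠ y i
  have h1 : ∀ i, (¬ x i ≠ y i) ↔ x i ≠ !y i := fun i => by cases x i <;> cases y i <;> simp
  simp only [h1] at h
  simpa [hammingDist] using h

/-- Each bit `z p` is written as a block of `g` copies of `!z p` and a block of `g` copies of `z p`,
so the weight of `X z` is constant. `Y i` is 1 on the first block of pair `i`: that pair contributes
`0` or `2 * g` to the distance, every other pair `g`. The other pairs use up coordinates of type 10
and 00, hence the conditions on `B` and `E`. -/
theorem exists_gap_strings {A B D E g m n : ℕ} (hB : m * g ≤ B + g) (hE : m * g ≤ E + g)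
    (hn : n = A + B + D + E + 2 * g) :
    ∃ (X : BitStr m → BitStr n) (Y : Fin m → BitStr n), ∀ z i,
      hammingWeight (X z) = A + B + g ∧ hammingWeight (Y i) = A + D + g ∧
        hammingDist (X z) (Y i) = B + D + if z i = true then 2 * g else 0 := by
  obtain ⟨B', hB'⟩ := Nat.exists_eq_add_of_le hB
  obtain ⟨E', hE'⟩ := Nat.exists_eq_add_of_le hE
  let ι := (Fin m × Fin g) ⊕ (Fin m × Fin g) ⊕ Fin A ⊕ Fin B' ⊕ Fin D ⊕ Fin E'
  let e : Fin n ≃ ι := Fintype.equivOfCardEq (by simp [ι]; omega)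
  let X : BitStr m → ι → Bool := fun z =>
    Sum.elim (fun p => !z p.1) <| Sum.elim (fun p => z p.1) <| Sum.elim (fun _ => true) <|
      Sum.elim (fun _ => true) <| Sum.elim (fun _ => false) fun _ => false
  let Y : Fin m → ι → Bool := fun i =>
    Sum.elim (fun p => p.1 == i) <| Sum.elim (fun _ => false) <| Sum.elim (fun _ => true) <|
      Sum.elim (fun _ => false) <| Sum.elim (fun _ => true) fun _ => false
  refine ⟨fun z j => X z (e j), fun i j => Y i (e j), fun z i => ?_⟩
  rw [hammingWeight_comp_equiv, hammingWeight_comp_equiv, hammingDist_comp_equiv]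
  have hX : ∑ p, (g * (!z p).toNat + g * (z p).toNat) = m * g := by
    have h1 : ∀ p, g * (!z p).toNat + g * (z p).toNat = g := fun p => by cases z p <;> simp
    rw [Finset.sum_congr rfl fun p _ => h1 p]
    simp
  have hY : ∑ p, g * (p == i).toNat = g := by
    rw [Finset.sum_eq_single i (fun p _ hp => by simp [hp]) (by simp)]
    simp
  have hd : ∑ p, (g * (!z p ^^ (p == i)).toNat + g * (z p).toNat) + g =
      m * g + if z i = true then 2 * g else 0 := by
    rw [← hX, Finset.sum_eq_add_sum_sdiff_singleton_of_mem (Finset.mem_univ i),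
      Finset.sum_eq_add_sum_sdiff_singleton_of_mem (s := Finset.univ) (Finset.mem_univ i)]
    have h1 : ∀ p ∈ Finset.univ \ {i}, g * (!z p ^^ (p == i)).toNat + g * (z p).toNat =
        g * (!z p).toNat + g * (z p).toNat := by
      intro p hp
      have hpi : p ≠ i := by simpa using hp
      rw [beq_false_of_ne hpi, Bool.xor_false]
    rw [Finset.sum_congr rfl h1]
    cases z i <;> simp <;> omega
  rw [Finset.sum_add_distrib] at hX hd
  simp only [ι, X, Y, Fintype.sum_sum_type, Fintype.sum_prod_type, Sum.elim_inl, Sum.elim_inr,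
    Finset.sum_const, Finset.card_univ, Fintype.card_fin, smul_eq_mul, Bool.toNat_true,
    Bool.toNat_false, Bool.xor_false, Bool.xor_true, Bool.not_true, Bool.not_false, mul_one,
    mul_zero]
  exact ⟨by omega, by omega, by omega⟩

theorem indexEmbeds_exactGHD_of_le {A B D E g m n : ℕ} (hg : 0 < g) (hB : m * g ≤ B + g)
    (hE : m * g ≤ E + g) (hn : n = A + B + D + E + 2 * g) :
    IndexEmbeds m (exactGHD n (A + B + g) (A + D + g) (B + D + g) g) := by
  obtain ⟨X, Y, h⟩ := exists_gap_strings hB hE hn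
  refine ⟨X, Y, fun z i => ?_⟩
  obtain ⟨h1, h2, h3⟩ := h z i
  rw [exactGHD, if_pos ⟨h1, h2⟩, h3]
  cases z i
  · rw [if_neg (by simp; omega), if_pos (by simp)]
  · rw [if_pos (by simp; omega)]

/-- Complementing `y` exchanges `A` with `B` and `D` with `E`, and turns distance `d` into `n - d`.
This flips the answer, so `z` is negated too. -/
theorem indexEmbeds_exactGHD_of_le' {A B D E g m n : ℕ} (hg : 0 < g) (hA : m * g ≤ A + g)
    (hD : m * g ≤ D + g) (hn : n = A + B + D + E + 2 * g) :
    IndexEmbeds m (exactGHD n (A + B + g) (A + D + g) (B + D + g) g) := by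
  obtain ⟨X, Y, h⟩ := exists_gap_strings (A := B) (D := E) hA hD
    (show n = B + A + E + D + 2 * g by omega)
  refine ⟨fun z => X fun i => !z i, fun i j => !Y i j, fun z i => ?_⟩
  obtain ⟨h1, h2, h3⟩ := h (fun i => !z i) i
  have h4 := hammingWeight_not (Y i)
  have h5 := hammingDist_not_right (X fun i => !z i) (Y i)
  beta_reduce
  rw [exactGHD, if_pos ⟨by omega, by omega⟩]
  cases hz : z i
  · rw [hz] at h3
    simp only [Bool.not_false, if_true] at h3
    rw [if_neg (by omega), if_pos (by omega)]
  · rw [hz] at h3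
    simp only [Bool.not_true, Bool.false_eq_true, if_false] at h3
    rw [if_pos (by omega)]

/-! ### From joint counts to the two bounds -/

theorem exists_joint_counts {n : ℕ} (x y : BitStr n) :
    ∃ p q r s : ℕ, n = p + q + r + s ∧ hammingWeight x = p + q ∧ hammingWeight y = p + r ∧
      hammingDist x y = q + r := by
  refine ⟨∑ i, if x i = true ∧ y i = true then 1 else 0,
    ∑ i, if x i = true ∧ y i = false then 1 else 0,
    ∑ i, if x i = false ∧ y i = true then 1 else 0,
    ∑ i, if x i = false ∧ y i = false then 1 else 0, ?_, ?_, ?_, ?_⟩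
  · simp only [← Finset.sum_add_distrib]
    conv_lhs => rw [← Fintype.card_fin n, Fintype.card_eq_sum_ones]
    refine Finset.sum_congr rfl fun i _ => ?_
    cases x i <;> cases y i <;> simp
  all_goals
    simp only [hammingWeight, hammingDist, Finset.card_filter, ← Finset.sum_add_distrib]
    refine Finset.sum_congr rfl fun i _ => ?_
    cases x i <;> cases y i <;> simp

theorem MeaningfulGHD.exists_counts {n a b c g : ℕ} (h : MeaningfulGHD n a b c g) :
    ∃ A B D E : ℕ, n = A + B + D + E + 2 * g ∧ a = A + B + g ∧ b = A + D + g ∧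
      c = B + D + g := by
  obtain ⟨-, -, -, ⟨x, y, hx, hy, hxy⟩, ⟨u, v, hu, hv, huv⟩⟩ := h
  obtain ⟨p, q, r, s, h1, h2, h3, h4⟩ := exists_joint_counts x y
  obtain ⟨p', q', r', s', h1', h2', h3', h4'⟩ := exists_joint_counts u v
  -- With equal weights, going from distance `c - g` to `c + g` moves `g` coordinates from each of
  -- 11 and 00 to each of 10 and 01. The witnesses are the smaller count of each type.
  exact ⟨p, q', r', s, by omega, by omega, by omega, by omega⟩

theorem exactGHD_swap (n a b c g : ℕ) :
    (fun x y => exactGHD n a b c g y x) = exactGHD n b a c g := by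
  funext x y
  simp only [exactGHD, hammingDist_comm y x, and_comm]

theorem exists_computes_oneWayCC {n : ℕ} (f : BitStr n → BitStr n → Option Bool) :
    ∃ π : OneWayProtocol n (oneWayCC f), π.Computes f :=
  Nat.sInf_mem (oneWayCC_set_nonempty f)

theorem IndexEmbeds.le_oneWayCC {n m : ℕ} {f : BitStr n → BitStr n → Option Bool}
    (hf : IndexEmbeds m f) : m ≤ 15 * oneWayCC f := by
  obtain ⟨π, hπ⟩ := exists_computes_oneWayCC f
  exact hf.le_of_computes hπ

theorem IndexEmbeds.le_two_pow_oneWayCC {n m : ℕ} {f : BitStr n → BitStr n → Option Bool}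
    (hf : IndexEmbeds m fun x y => f y x) : m ≤ 15 * 2 ^ oneWayCC f := by
  obtain ⟨π, hπ⟩ := exists_computes_oneWayCC f
  exact hf.le_of_computes hπ.transpose

/-- The extra block in `⌊min B E / g⌋ + 1` guarantees `1 ≤ m`, which makes the complexity positive.
-/
theorem exists_block_count {g : ℕ} (hg : 0 < g) (B E : ℕ) :
    ∃ m, 1 ≤ m ∧ m * g ≤ B + g ∧ m * g ≤ E + g ∧ (B ≤ m * g ∨ E ≤ m * g) := by
  refine ⟨min B E / g + 1, Nat.le_add_left 1 _, ?_⟩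
  have h1 := Nat.div_mul_le_self (min B E) g
  have h2 := Nat.lt_div_mul_add (a := min B E) hg
  rw [add_mul, one_mul]
  omega

theorem min_le_oneWayCC {A B D E g n : ℕ} (hg : 0 < g) (hn : n = A + B + D + E + 2 * g) :
    1 ≤ oneWayCC (exactGHD n (A + B + g) (A + D + g) (B + D + g) g) ∧
    min B E ≤ 15 * oneWayCC (exactGHD n (A + B + g) (A + D + g) (B + D + g) g) * g ∧
    min A D ≤ 15 * oneWayCC (exactGHD n (A + B + g) (A + D + g) (B + D + g) g) * g := by
  obtain ⟨m, hm1, hm2, hm3, hm4⟩ := exists_block_count hg B E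
  obtain ⟨l, hl1, hl2, hl3, hl4⟩ := exists_block_count hg A D
  have h1 := (indexEmbeds_exactGHD_of_le hg hm2 hm3 hn).le_oneWayCC
  have h2 := (indexEmbeds_exactGHD_of_le' hg hl2 hl3 hn).le_oneWayCC
  have h3 := Nat.mul_le_mul_right g h1
  have h4 := Nat.mul_le_mul_right g h2
  exact ⟨by omega, by omega, by omega⟩

theorem min_le_two_pow_oneWayCC {A B D E g n : ℕ} (hg : 0 < g)
    (hn : n = A + B + D + E + 2 * g) :
    min D E ≤ 15 * 2 ^ oneWayCC (exactGHD n (A + B + g) (A + D + g) (B + D + g) g) * g ∧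
    min A B ≤ 15 * 2 ^ oneWayCC (exactGHD n (A + B + g) (A + D + g) (B + D + g) g) * g := by
  obtain ⟨m, hm1, hm2, hm3, hm4⟩ := exists_block_count hg D E
  obtain ⟨l, hl1, hl2, hl3, hl4⟩ := exists_block_count hg A B
  have hn' : n = A + D + B + E + 2 * g := by omega
  have e1 := indexEmbeds_exactGHD_of_le hg hm2 hm3 hn'
  have e2 := indexEmbeds_exactGHD_of_le' hg hl2 hl3 hn'
  rw [add_comm D B, ← exactGHD_swap] at e1 e2
  have h3 := Nat.mul_le_mul_right g e1.le_two_pow_oneWayCC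
  have h4 := Nat.mul_le_mul_right g e2.le_two_pow_oneWayCC
  exact ⟨by omega, by omega⟩

theorem exactGHD_oneWayCC_bounds {n a b c g : ℕ} (h : MeaningfulGHD n a b c g) :
    1 ≤ oneWayCC (exactGHD n a b c g) ∧ g ≤ c ∧ c + g ≤ n ∧
    min (min a (n - a)) (min c (n - c)) ≤ 45 * oneWayCC (exactGHD n a b c g) * g ∧
    min c (n - c) ≤ 45 * 2 ^ oneWayCC (exactGHD n a b c g) * g := by
  have hg := h.1
  obtain ⟨A, B, D, E, hn, rfl, rfl, rfl⟩ := h.exists_counts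
  obtain ⟨h1, h2, h3⟩ := min_le_oneWayCC hg hn
  obtain ⟨h4, h5⟩ := min_le_two_pow_oneWayCC hg hn
  generalize oneWayCC (exactGHD n (A + B + g) (A + D + g) (B + D + g) g) = R at *
  have h6 : 1 * g ≤ R * g := Nat.mul_le_mul_right g h1
  have h7 : R * g ≤ 2 ^ R * g := Nat.mul_le_mul_right g Nat.lt_two_pow_self.le
  rw [mul_assoc] at h2 h3 h4 h5
  rw [mul_assoc, mul_assoc]
  -- Two suitable counts are at most `15 * R * g` each; with the extra `g ≤ R * g` this gives at
  -- most `31 * R * g`. For the last bound `2 ^ R` replaces `R`, and either `B`, `D` or `A`, `E` are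
  -- both small.
  refine ⟨h1, ?_, ?_, ?_, ?_⟩ <;> omega

theorem mainTheorem10 :
    ∃ C : ℝ, 0 < C ∧ ∀ n a b c g : ℕ, MeaningfulGHD n a b c g →
      (1 / C) * (min (min (a : ℝ) ((n : ℝ) - a)) (min (c : ℝ) ((n : ℝ) - c)) / g)
          ≤ (oneWayCC (exactGHD n a b c g) : ℝ) ∧
      (1 / C) * Real.logb 2 (min (c : ℝ) ((n : ℝ) - c) / g)
          ≤ (oneWayCC (exactGHD n a b c g) : ℝ) := by
  refine ⟨45, by norm_num, fun n a b c g h => ?_⟩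
  obtain ⟨h1, h2, h3, h4, h5⟩ := exactGHD_oneWayCC_bounds h
  obtain ⟨hg, han, -, -, -⟩ := h
  generalize oneWayCC (exactGHD n a b c g) = R at *
  have hcn : c ≤ n := by omega
  have hgR : (0 : ℝ) < g := by exact_mod_cast hg
  have h1R : (1 : ℝ) ≤ R := by exact_mod_cast h1
  rw [← Nat.cast_sub han, ← Nat.cast_sub hcn, ← Nat.cast_min, ← Nat.cast_min, ← Nat.cast_min]
  constructor
  · have h4R : ((min (min a (n - a)) (min c (n - c)) : ℕ) : ℝ) ≤ 45 * R * g := by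
      exact_mod_cast h4
    have := (div_le_iff₀ hgR).2 h4R
    linarith
  · have h5R : ((min c (n - c) : ℕ) : ℝ) ≤ 45 * 2 ^ R * g := by exact_mod_cast h5
    have hpos : (0 : ℝ) < (min c (n - c) : ℕ) := by
      have : 0 < min c (n - c) := by omega
      exact_mod_cast this
    -- `45 ≤ 2 ^ 6`, and `R + 6 ≤ 45 * R` because `1 ≤ R`.
    have h6 : ((min c (n - c) : ℕ) : ℝ) / g ≤ 2 ^ (R + 6) := by
      refine ((div_le_iff₀ hgR).2 h5R).trans ?_
      rw [pow_add]
      nlinarith [pow_pos (two_pos : (0 : ℝ) < 2) R]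
    have h7 := Real.logb_le_logb_of_le one_lt_two (div_pos hpos hgR) h6
    rw [Real.logb_pow, Real.logb_self_eq_one one_lt_two] at h7
    rw [Nat.cast_add, Nat.cast_ofNat] at h7
    linarith
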